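/- Let $q$ be a prime power, $n\ge 0$ an integer and $K$ a field. Let $L(n,q)$ be the Hasse graph of the lattice of subspaces of $\mathbf F_q^n$: its vertices are the subspaces of $\mathbf F_q^n$, and there is exactly one directed edge from $U$ (its tail) to $W$ (its head) whenever $W\subset U$ and $\dim U=\dim W+1$. Let $E$ be its set of edges and let $T(E)$ be the free associative $K$-algebra on $E$. For a path $\pi$ consisting of edges $e_1,\dots,e_m$ (the tail of $e_{i+1}$ being the head of $e_i$), define $e(\pi,k)\in T(E)$, $0\le k\le m$, by $$(\tau-e_1)(\tau-e_2)\cdots(\tau-e_m)=\sum_{k=0}^m e(\pi,k)\,\tau^{m-k},$$ where $\tau$ is a central variable. Let $A(L(n,q))$ be the quotient of $T(E)$ by the two-sided ideal generated by all $e(\pi_1,k)-e(\pi_2,k)$, where $\pi_1,\pi_2$ are paths from the same starting vertex to the same final vertex and $1\le k\le m$, $m$ being the length of $\pi_1$ (and of $\pi_2$). These generators are homogeneous, so $A(L(n,q))$ is graded with all edges in degree $1$; let $H(A(L(n,q)),t)=\sum_{i\ge0}\dim_K A(L(n,q))_i\,t^i$ be its Hilbert series. Then, as formal power series in $t$, $$\frac{1-t}{H(A(L(n,q)),t)}=1-t\sum_{m=0}^n\binom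 nm_q(1-t)(1-tq)\cdots(1-tq^{n-m-1}),$$ where $\binom nm_q=\prod_{i=0}^{m-1}\frac{q^{n-i}-1}{q^{i+1}-1}$ is the $q$-binomial coefficient and the product $(1-t)\cdots(1-tq^{n-m-1})$ is $1$ for $m=n$. -/

import Mathlib

/-- A layered directed graph with vertices `V` and edges `E`: the vertices have levels
`0, …, height`, and every edge goes down by exactly one level. (Multiple edges are allowed.) -/
structure LayeredGraph (V : Type*) (E : Type*) where
  tail : E → V
  head : E → V
  level : V → ℕ
  height : ℕ
  level_le : ∀ v, level v ≤ height
  level_tail : ∀ e, level (tail e) = level (head e) + 1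

namespace LayeredGraph

variable {V : Type*} {E : Type*} (Γ : LayeredGraph V E)

/-- `Γ.IsPath v π w`: the list of edges `π = [e₁, …, eₘ]` is a path from `v` to `w`, that is,
`e₁` has tail `v`, the tail of `eᵢ₊₁` is the head of `eᵢ`, and `eₘ` has head `w`. -/
def IsPath : V → List E → V → Prop
  | v, [], w => v = w
  | v, e :: π, w => Γ.tail e = v ∧ IsPath (Γ.head e) π w

end LayeredGraph

/-- The polynomial `P_π(τ) = (τ - e₁)(τ - e₂)⋯(τ - eₘ)` over the free associative algebra on the
set of edges; the variable `τ` is central. -/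
noncomputable def pathPoly (K : Type*) [Field K] {E : Type*} (π : List E) :
    Polynomial (FreeAlgebra K E) :=
  (π.map fun e => (Polynomial.X - Polynomial.C (FreeAlgebra.ι K e))).prod

/-- The element `e(π, k)`, defined for `k ≤ m` by `P_π(τ) = ∑ₖ e(π, k) τ^(m - k)`, where `m` is the
length of `π`. -/
noncomputable def pathCoeff (K : Type*) [Field K] {E : Type*} (π : List E) (k : ℕ) :
    FreeAlgebra K E :=
  (pathPoly K π).coeff (π.length - k)

namespace LayeredGraph

variable {V : Type*} {E : Type*} (Γ : LayeredGraph V E) (K : Type*) [Field K]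

/-- The defining relations of `A(Γ)`: `e(π₁, k) = e(π₂, k)` for all paths `π₁`, `π₂` with the same
tail and the same head, and all `1 ≤ k ≤ l(π₁)`. -/
def Rel (x y : FreeAlgebra K E) : Prop :=
  ∃ (v w : V) (π₁ π₂ : List E) (k : ℕ), Γ.IsPath v π₁ w ∧ Γ.IsPath v π₂ w ∧
    1 ≤ k ∧ k ≤ π₁.length ∧ x = pathCoeff K π₁ k ∧ y = pathCoeff K π₂ k

/-- The algebra `A(Γ)` over the field `K`: the quotient of the free associative algebra on the
edges by the two-sided ideal generated by the differences `e(π₁, k) - e(π₂, k)`. -/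
abbrev GraphAlgebra : Type _ := RingQuot (Γ.Rel K)

/-- The homogeneous component of degree `i` of `A(Γ)`, all edges having degree one: the image of
the span of the words of length `i` in the edges. -/
noncomputable def component (i : ℕ) : Submodule K (Γ.GraphAlgebra K) :=
  ((Submodule.span K (Set.range (FreeAlgebra.ι K : E → FreeAlgebra K E))) ^ i).map
    (RingQuot.mkAlgHom K (Γ.Rel K)).toLinearMap

/-- For finitely many edges the homogeneous components are finite-dimensional. -/
theorem finite_component [Finite E] (i : ℕ) : Module.Finite K (Γ.component K i) :=
  Module.Finite.iff_fg.2 (((Submodule.fg_span (Set.finite_range _)).pow i).map _)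

/-- The Hilbert series `H(A(Γ), t) = ∑ᵢ (dim A(Γ)ᵢ) tⁱ`. -/
noncomputable def hilbertSeries : PowerSeries ℚ :=
  PowerSeries.mk fun i => (Module.finrank K (Γ.component K i) : ℚ)

end LayeredGraph

theorem finrank_eq_of_covBy {F M : Type*} [Field F] [AddCommGroup M] [Module F M]
    [FiniteDimensional F M] {W U : Submodule F M} (h : W ⋖ U) :
    Module.finrank F U = Module.finrank F W + 1 := by
  have h1 := isSimpleModule_iff_finrank_eq_one.1 ((covBy_iff_quot_is_simple h.le).1 h)
  have h2 := Submodule.finrank_quotient_add_finrank (W.comap U.subtype)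
  have h3 := (Submodule.comapSubtypeEquivOfLe h.le).finrank_eq
  omega

/-- `L(n, q)` for a field `F` with `q` elements: the Hasse graph of the lattice of subspaces of
`Fⁿ`. The vertices are the subspaces, the level of a subspace is its dimension, and there is exactly
one edge with tail `U` and head `W` whenever `U` covers `W`. -/
noncomputable def subspaceGraph (F : Type*) [Field F] (n : ℕ) :
    LayeredGraph (Submodule F (Fin n → F))
      {p : Submodule F (Fin n → F) × Submodule F (Fin n → F) // p.2 ⋖ p.1} where
  tail e := e.1.1
  head e := e.1.2
  level U := Module.finrank F U
  height := n
  level_le U := by simpa using Submodule.finrank_le U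
  level_tail e := finrank_eq_of_covBy e.2

/-- The `q`-binomial coefficient
`((qⁿ - 1)(qⁿ⁻¹ - 1)⋯(qⁿ⁻ᵐ⁺¹ - 1)) / ((q - 1)(q² - 1)⋯(qᵐ - 1))`, for `m ≤ n` and `q ≥ 2`. -/
def qBinomial (q n m : ℕ) : ℚ :=
  ∏ i ∈ Finset.range m, (((q : ℚ) ^ (n - i) - 1) / ((q : ℚ) ^ (i + 1) - 1))

/-! In `A(Γ)` the coefficients of a path from `v` down to `⊥` depend only on `v`; call them `e(v,
k)` and put `E_v(s) = ∑ e(v, k) s^k`. An edge from `v` to `w` equals `e(w, 1) - e(v, 1)`. Let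
`letter v k j` be the coefficients in `s^j` of `E_v⁻¹ · ∑ₘ e(v, k+1+m) s^m`. For `x ≤ v` one has
`E_v = Q E_x` with `Q` of degree `level v - level x`, so the coefficients of `E_v · ∑ⱼ (letter x k
j) s^j` from that degree on are the `e(v, k+m+1)` (`sum_vertexCoeff_mul_letter`). This rewrites
`e(v, 1) * letter x k j` for large `j`; the words without such a product are the normal ones. To see
that they form a basis, `A(Γ)` is made to act on formal words by the rewriting rule
(`isFactorFamily_wordOp`); applying an element to the empty word gives its expansion.

The Hilbert series `H` thus counts normal words. If `S_x` counts those with first vertex `x`, the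
bijection `attach` yields `∑_{x ≤ v} t^(level v - level x) S_x = (t + ⋯ + t^(level v)) H`, a
triangular system for the `S_x`. For subspaces, `sum_qBinomial_mul_qPochhammer` solves it, and `H =
1 + ∑ S_x` gives the formula. -/

namespace LayeredGraph

/-! ### Coefficients of path polynomials. -/

section PathCoefficients

variable (K : Type*) [Field K] {E : Type*}

/-- The coefficients `e(π, k)` computed recursively, with `e(π, k) = 0` for `k` larger than the
length of `π`. -/
noncomputable def coeffRec : List E → ℕ → FreeAlgebra K E
  | _, 0 => 1
  | [], _ + 1 => 0
  | e :: π, k + 1 => coeffRec π (k + 1) - FreeAlgebra.ι K e * coeffRec π k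

@[simp] theorem coeffRec_zero (π : List E) : coeffRec K π 0 = 1 := by
  cases π <;> rfl

@[simp] theorem coeffRec_nil_succ (k : ℕ) : coeffRec K ([] : List E) (k + 1) = 0 := rfl

theorem coeffRec_cons_succ (e : E) (π : List E) (k : ℕ) :
    coeffRec K (e :: π) (k + 1) = coeffRec K π (k + 1) - FreeAlgebra.ι K e * coeffRec K π k := rfl

theorem coeffRec_of_length_lt (π : List E) (k : ℕ) (h : π.length < k) : coeffRec K π k = 0 := by
  induction π generalizing k with
  | nil =>
    obtain ⟨k, rfl⟩ : ∃ j, k = j + 1 := ⟨k - 1, by simp at h; omega⟩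
    rfl
  | cons e π ih =>
    obtain ⟨k, rfl⟩ : ∃ j, k = j + 1 := ⟨k - 1, by simp at h; omega⟩
    rw [List.length_cons] at h
    rw [coeffRec_cons_succ, ih _ (by omega), ih _ (by omega)]
    simp

theorem coeff_pathPoly (π : List E) (i k : ℕ) (h : i + k = π.length) :
    (pathPoly K π).coeff i = coeffRec K π k := by
  induction π generalizing i k with
  | nil =>
    obtain ⟨rfl, rfl⟩ : i = 0 ∧ k = 0 := by simpa using h
    simp [pathPoly]
  | cons e π ih =>
    have hp : pathPoly K (e :: π) =
        (Polynomial.X - Polynomial.C (FreeAlgebra.ι K e)) * pathPoly K π := by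
      simp [pathPoly]
    have htop : ∀ j, π.length < j → (pathPoly K π).coeff j = 0 := by
      intro j hj
      apply Polynomial.coeff_eq_zero_of_natDegree_lt
      refine lt_of_le_of_lt ?_ hj
      have := Polynomial.natDegree_list_prod_le
        (π.map fun e => (Polynomial.X - Polynomial.C (FreeAlgebra.ι K e)))
      refine this.trans ?_
      rw [List.map_map]
      refine (List.sum_le_card_nsmul _ 1 ?_).trans (by simp)
      simp only [List.mem_map, Function.comp]
      rintro x ⟨a, -, rfl⟩
      exact Polynomial.natDegree_X_sub_C_le _
    rw [List.length_cons] at h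
    rw [hp, sub_mul, Polynomial.coeff_sub, Polynomial.coeff_C_mul]
    rcases k with _ | k
    · obtain rfl : i = π.length + 1 := by omega
      rw [Polynomial.coeff_X_mul, htop _ (Nat.lt_succ_self _), ih _ 0 (by omega)]
      simp
    · rw [coeffRec_cons_succ, ih i k (by omega)]
      rcases i with _ | i
      · rw [coeffRec_of_length_lt K π (k + 1) (by omega)]
        simp
      · rw [Polynomial.coeff_X_mul, ih i (k + 1) (by omega)]

theorem pathCoeff_eq_coeffRec (π : List E) (k : ℕ) (h : k ≤ π.length) :
    pathCoeff K π k = coeffRec K π k :=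
  coeff_pathPoly K π _ _ (by omega)

theorem coeffRec_mem (π : List E) (k : ℕ) :
    coeffRec K π k ∈
      (Submodule.span K (Set.range (FreeAlgebra.ι K : E → FreeAlgebra K E))) ^ k := by
  induction π generalizing k with
  | nil =>
    rcases k with _ | k
    · rw [coeffRec_zero, pow_zero]
      exact Submodule.one_le.1 le_rfl
    · exact zero_mem _
  | cons e π ih =>
    rcases k with _ | k
    · rw [coeffRec_zero, pow_zero]
      exact Submodule.one_le.1 le_rfl
    · rw [coeffRec_cons_succ]
      refine sub_mem (ih _) ?_
      rw [pow_succ']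
      exact Submodule.mul_mem_mul (Submodule.subset_span ⟨e, rfl⟩) (ih k)

end PathCoefficients

/-! ### Families of monic polynomials compatible with the edges. -/

section Families

variable {V E : Type*} (Γ : LayeredGraph V E) (K : Type*) [Field K]

theorem IsPath.level_eq {Γ : LayeredGraph V E} {v w : V} {π : List E} (h : Γ.IsPath v π w) :
    Γ.level v = Γ.level w + π.length := by
  induction π generalizing v with
  | nil => obtain rfl : v = w := h; rfl
  | cons e π ih =>
    obtain ⟨rfl, h⟩ := h
    rw [Γ.level_tail, ih h, List.length_cons, add_assoc]

variable {R : Type*} [Ring R] [Algebra K R]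

/-- A family of elements `g v k`, thought of as the coefficients of monic polynomials `P_v`, such
that `P_v = (τ - e) P_w` for every edge `e` from `v` to `w`. -/
structure IsFactorFamily (f : FreeAlgebra K E →ₐ[K] R) (g : V → ℕ → R) : Prop where
  zero : ∀ v, g v 0 = 1
  edge : ∀ e k, g (Γ.tail e) (k + 1) =
    g (Γ.head e) (k + 1) - f (FreeAlgebra.ι K e) * g (Γ.head e) k

variable {Γ K} {f : FreeAlgebra K E →ₐ[K] R} {g : V → ℕ → R}

/-- Iterating the edge relation along `π` gives `P_v = P_π P_w`; this is the Cauchy product of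
coefficients. -/
theorem IsFactorFamily.eq_sum (hg : Γ.IsFactorFamily K f g) {v w : V} {π : List E}
    (h : Γ.IsPath v π w) (k : ℕ) :
    g v k = ∑ i ∈ Finset.range (k + 1), f (coeffRec K π i) * g w (k - i) := by
  induction π generalizing v k with
  | nil =>
    obtain rfl : v = w := h
    rw [Finset.sum_range_succ']
    simp
  | cons e π ih =>
    obtain ⟨rfl, h⟩ := h
    rcases k with _ | k
    · simp [hg.zero]
    · rw [hg.edge, ih h, ih h, Finset.sum_range_succ', Finset.sum_range_succ' _ (k + 1),
        Finset.mul_sum, add_sub_right_comm, ← Finset.sum_sub_distrib]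
      congr 1
      · refine Finset.sum_congr rfl fun i _ => ?_
        rw [coeffRec_cons_succ, map_sub, map_mul, sub_mul, mul_assoc, Nat.add_sub_add_right]
      · simp

/-- The monic `P_w` can be cancelled on the right in `P_v = P_π P_w`. Hence `f` respects the
relations and descends to `A(Γ)` whenever a factor family exists. -/
theorem IsFactorFamily.map_coeffRec_eq (hg : Γ.IsFactorFamily K f g) {v w : V} {π₁ π₂ : List E}
    (h₁ : Γ.IsPath v π₁ w) (h₂ : Γ.IsPath v π₂ w) (k : ℕ) :
    f (coeffRec K π₁ k) = f (coeffRec K π₂ k) := by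
  induction k using Nat.strong_induction_on with
  | _ k ih =>
    have h := (hg.eq_sum h₁ k).symm.trans (hg.eq_sum h₂ k)
    rw [Finset.sum_range_succ, Finset.sum_range_succ,
      Finset.sum_congr rfl fun i hi => by rw [ih i (Finset.mem_range.1 hi)]] at h
    simpa [hg.zero] using h

theorem IsFactorFamily.map_eq_of_rel (hg : Γ.IsFactorFamily K f g) ⦃x y : FreeAlgebra K E⦄
    (h : Γ.Rel K x y) : f x = f y := by
  obtain ⟨v, w, π₁, π₂, k, h₁, h₂, -, hk, rfl, rfl⟩ := h
  have := h₁.level_eq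
  have := h₂.level_eq
  rw [pathCoeff_eq_coeffRec K π₁ k hk, pathCoeff_eq_coeffRec K π₂ k (by omega)]
  exact hg.map_coeffRec_eq h₁ h₂ k

theorem IsFactorFamily.map_coeffRec (hg : Γ.IsFactorFamily K f g) {v w : V} {π : List E}
    (h : Γ.IsPath v π w) (hw : ∀ k, g w (k + 1) = 0) (k : ℕ) :
    f (coeffRec K π k) = g v k := by
  rw [hg.eq_sum h, Finset.sum_range_succ, Finset.sum_eq_zero]
  · simp [hg.zero]
  · intro i hi
    obtain ⟨j, hj⟩ : ∃ j, k - i = j + 1 := ⟨k - i - 1, by have := Finset.mem_range.1 hi; omega⟩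
    rw [hj, hw, mul_zero]

end Families

end LayeredGraph

namespace LayeredGraph

/-! ### Action of the algebra on formal words, and the normal words. -/

section Words

variable {V E : Type*} (Γ : LayeredGraph V E) (K : Type*) [Field K]

/-- The layered graph is the Hasse graph (possibly with multiple edges) of a graded partial order
with a smallest element of level `0`. -/
structure IsGraded [PartialOrder V] [OrderBot V] : Prop where
  head_lt_tail : ∀ e, Γ.head e < Γ.tail e
  exists_edge : ∀ {x v : V}, x < v → ∃ e, Γ.tail e = v ∧ x ≤ Γ.head e
  level_bot : Γ.level ⊥ = 0
  level_strictMono : StrictMono Γ.level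

variable {Γ} in
theorem IsGraded.exists_isPath_bot [PartialOrder V] [OrderBot V] (hΓ : Γ.IsGraded) (v : V) :
    ∃ π, Γ.IsPath v π ⊥ := by
  induction hd : Γ.level v generalizing v with
  | zero =>
    refine ⟨[], ?_⟩
    by_contra h
    have := hΓ.level_strictMono (bot_lt_iff_ne_bot.2 h)
    omega
  | succ d ih =>
    have hv : ⊥ < v := by
      refine bot_lt_iff_ne_bot.2 ?_
      rintro rfl
      rw [hΓ.level_bot] at hd
      omega
    obtain ⟨e, rfl, -⟩ := hΓ.exists_edge hv
    obtain ⟨π, hπ⟩ := ih (Γ.head e) (by have := Γ.level_tail e; omega)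
    exact ⟨e :: π, rfl, hπ⟩

/-- The sum of the degrees of the letters of a word: a letter `(v, k, j)` has degree `k + 1 + j`. -/
def wordDegree : List (V × ℕ × ℕ) → ℕ
  | [] => 0
  | (_, k, j) :: u => k + 1 + j + wordDegree u

open Classical in
/-- The word `u`, preceded by the letter `(v, k, 0)` if `k` is less than the level of `v`. -/
noncomputable def consWord (v : V) (k : ℕ) (u : List (V × ℕ × ℕ)) : List (V × ℕ × ℕ) →₀ K :=
  if k < Γ.level v then Finsupp.single ((v, k, 0) :: u) 1 else 0

variable {Γ} in
theorem consWord_of_lt {v : V} {k : ℕ} (h : k < Γ.level v) (u : List (V × ℕ × ℕ)) :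
    Γ.consWord K v k u = Finsupp.single ((v, k, 0) :: u) 1 := by
  rw [consWord, if_pos h]

variable {Γ} in
theorem consWord_of_le {v : V} {k : ℕ} (h : Γ.level v ≤ k) (u : List (V × ℕ × ℕ)) :
    Γ.consWord K v k u = 0 := by
  rw [consWord, if_neg h.not_gt]

variable [PartialOrder V]

/-- The product of `e(v, 1)` with the word can be expressed by other words. -/
def Absorbs (v : V) : List (V × ℕ × ℕ) → Prop
  | [] => False
  -- The last inequality is the range in which `sum_vertexCoeff_mul_letter` holds with `m = j + 1`.
  -- Positivity of the level of `x` lets `e(⊥, 1)` act as zero on all words.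
  | (x, _, j) :: _ => 0 < Γ.level x ∧ x ≤ v ∧ Γ.level v ≤ j + Γ.level x + 1

/-- The words which form a basis of the algebra `A(Γ)`. -/
def IsNormalWord : List (V × ℕ × ℕ) → Prop
  | [] => True
  | (v, k, _) :: u => k < Γ.level v ∧ ¬ (k = 0 ∧ Γ.Absorbs v u) ∧ IsNormalWord u

open Classical in
/-- The action of `e(v, 1)` on words. -/
noncomputable def firstWord (v : V) : List (V × ℕ × ℕ) → (List (V × ℕ × ℕ) →₀ K)
  | [] => Γ.consWord K v 0 []
  | (x, k, j) :: u =>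
    if Γ.Absorbs v ((x, k, j) :: u) then
      -- This is the identity `sum_vertexCoeff_mul_letter` for `m = j + 1`, solved for the product
      -- `e(v, 1) * letter x k j`.
      Γ.consWord K v (k + j + 1) u - Finsupp.single ((x, k, j + 1) :: u) 1 -
        ∑ l ∈ Finset.range j, Γ.consWord K v (j - l) ((x, k, l) :: u)
    else Γ.consWord K v 0 ((x, k, j) :: u)

/-- The action of `e(v, k)` on words. -/
noncomputable def wordOp (v : V) : ℕ → Module.End K (List (V × ℕ × ℕ) →₀ K)
  | 0 => 1
  | 1 => Finsupp.linearCombination K (Γ.firstWord K v)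
  | k + 2 => Finsupp.linearCombination K (Γ.consWord K v (k + 1))

/-- The edge `e` acts as `e(w, 1) - e(v, 1)`, where `v` is its tail and `w` its head. -/
noncomputable def freeAction :
    FreeAlgebra K E →ₐ[K] Module.End K (List (V × ℕ × ℕ) →₀ K) :=
  FreeAlgebra.lift K fun e => Γ.wordOp K (Γ.head e) 1 - Γ.wordOp K (Γ.tail e) 1

variable {Γ}

theorem firstWord_of_absorbs {v x : V} {k j : ℕ} {u : List (V × ℕ × ℕ)}
    (h : Γ.Absorbs v ((x, k, j) :: u)) :
    Γ.firstWord K v ((x, k, j) :: u) =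
      Γ.consWord K v (k + j + 1) u - Finsupp.single ((x, k, j + 1) :: u) 1 -
        ∑ l ∈ Finset.range j, Γ.consWord K v (j - l) ((x, k, l) :: u) := by
  rw [firstWord, if_pos h]

theorem firstWord_of_not_absorbs {v : V} {u : List (V × ℕ × ℕ)} (h : ¬ Γ.Absorbs v u) :
    Γ.firstWord K v u = Γ.consWord K v 0 u := by
  rcases u with _ | ⟨⟨x, k, j⟩, u⟩
  · rw [firstWord]
  · rw [firstWord, if_neg h]

@[simp] theorem wordOp_zero (v : V) : Γ.wordOp K v 0 = 1 := rfl

theorem wordOp_one_single (v : V) (u : List (V × ℕ × ℕ)) :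
    Γ.wordOp K v 1 (Finsupp.single u 1) = Γ.firstWord K v u := by
  simp [wordOp]

theorem wordOp_add_two_single (v : V) (k : ℕ) (u : List (V × ℕ × ℕ)) :
    Γ.wordOp K v (k + 2) (Finsupp.single u 1) = Γ.consWord K v (k + 1) u := by
  simp [wordOp]

theorem wordOp_of_pos (v : V) {k : ℕ} (hk : 0 < k) (u : List (V × ℕ × ℕ)) :
    Γ.wordOp K v (k + 1) (Finsupp.single u 1) = Γ.consWord K v k u := by
  obtain ⟨k, rfl⟩ := Nat.exists_eq_add_one.2 hk
  exact wordOp_add_two_single K v k u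

theorem firstWord_cons_of_lt {v w : V} {k : ℕ} (hk : k < Γ.level w) (hwv : w ≤ v)
    (h : Γ.level v ≤ Γ.level w + 1) (u : List (V × ℕ × ℕ)) :
    Γ.firstWord K v ((w, k, 0) :: u) =
      Γ.consWord K v (k + 1) u - Finsupp.single ((w, k, 1) :: u) 1 := by
  rw [firstWord_of_absorbs]
  · simp
  · exact ⟨by omega, hwv, by omega⟩

section Bot

variable [OrderBot V] (hΓ : Γ.IsGraded)
include hΓ

theorem IsGraded.wordOp_bot (k : ℕ) : Γ.wordOp K ⊥ (k + 1) = 0 := by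
  refine Finsupp.lhom_ext' fun u => LinearMap.ext_ring ?_
  change Γ.wordOp K ⊥ (k + 1) (Finsupp.single u 1) = 0
  rcases k with _ | k
  · rw [wordOp_one_single, firstWord_of_not_absorbs, consWord_of_le]
    · exact hΓ.level_bot.le
    · rcases u with _ | ⟨⟨x, k, j⟩, u⟩
      · exact id
      · rintro ⟨h0, hx, -⟩
        obtain rfl := le_bot_iff.1 hx
        exact h0.ne' hΓ.level_bot
  · rw [wordOp_add_two_single, consWord_of_le]
    exact hΓ.level_bot.le.trans (Nat.zero_le _)

/-- Both ends of the edge absorb the letter `(head, k, 0)`, and the words starting with `(head, k,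
1)` cancel. For `k` at least the level of the head all terms vanish, since the level of the tail is
only one higher. -/
theorem IsGraded.firstWord_sub_consWord (e : E) (k : ℕ) (u : List (V × ℕ × ℕ)) :
    (Γ.wordOp K (Γ.head e) 1 - Γ.wordOp K (Γ.tail e) 1) (Γ.consWord K (Γ.head e) k u) =
      Γ.consWord K (Γ.head e) (k + 1) u - Γ.consWord K (Γ.tail e) (k + 1) u := by
  have hl := Γ.level_tail e
  rcases lt_or_ge k (Γ.level (Γ.head e)) with hk | hk
  · rw [consWord_of_lt K hk, LinearMap.sub_apply, wordOp_one_single, wordOp_one_single,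
      firstWord_cons_of_lt K hk le_rfl (by omega),
      firstWord_cons_of_lt K hk (hΓ.head_lt_tail e).le hl.le]
    abel
  · rw [consWord_of_le K hk, consWord_of_le K (by omega), consWord_of_le K (by omega)]
    simp

/-- The consistency check of the rewriting rule. The delicate case is the coefficient of index two
on a word whose first letter `(x, κ, j)` is absorbed by the head: then both ends absorb `(x, κ, j +
1)`, and the two expansions differ only by terms covered by `firstWord_sub_consWord`. -/
theorem IsGraded.isFactorFamily_wordOp : Γ.IsFactorFamily K (Γ.freeAction K) (Γ.wordOp K) where
  zero v := rfl
  edge e k := by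
    have hl := Γ.level_tail e
    have hlt := hΓ.head_lt_tail e
    rw [freeAction, FreeAlgebra.lift_ι_apply]
    refine Finsupp.lhom_ext' fun u => LinearMap.ext_ring ?_
    change Γ.wordOp K (Γ.tail e) (k + 1) (Finsupp.single u 1) =
      Γ.wordOp K (Γ.head e) (k + 1) (Finsupp.single u 1) -
      (Γ.wordOp K (Γ.head e) 1 - Γ.wordOp K (Γ.tail e) 1)
        (Γ.wordOp K (Γ.head e) k (Finsupp.single u 1))
    rcases k with _ | _ | k
    · simp
    · rw [wordOp_add_two_single, wordOp_add_two_single, wordOp_one_single]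
      by_cases hu : Γ.Absorbs (Γ.head e) u
      · rcases u with _ | ⟨⟨x, κ, j⟩, u⟩
        · exact hu.elim
        · have h1 := firstWord_of_absorbs K
            (show Γ.Absorbs (Γ.head e) ((x, κ, j + 1) :: u) from
              ⟨hu.1, hu.2.1, by have := hu.2.2; omega⟩)
          have h2 := firstWord_of_absorbs K
            (show Γ.Absorbs (Γ.tail e) ((x, κ, j + 1) :: u) from
              ⟨hu.1, hu.2.1.trans hlt.le, by have := hu.2.2; omega⟩)
          have hshift : ∀ v, ∑ l ∈ Finset.range j, Γ.consWord K v (j + 1 - l) ((x, κ, l) :: u) =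
              ∑ l ∈ Finset.range j, Γ.consWord K v (j - l + 1) ((x, κ, l) :: u) := fun v =>
            Finset.sum_congr rfl fun l hl => by
              rw [show j + 1 - l = j - l + 1 by have := Finset.mem_range.1 hl; omega]
          rw [firstWord_of_absorbs K hu, map_sub, map_sub, map_sum,
            hΓ.firstWord_sub_consWord K, Finset.sum_congr rfl fun l hl => by
              rw [hΓ.firstWord_sub_consWord K], Finset.sum_sub_distrib,
            LinearMap.sub_apply, wordOp_one_single, wordOp_one_single, h1, h2,
            Finset.sum_range_succ, Finset.sum_range_succ, hshift, hshift]
          simp only [Nat.add_sub_cancel_left, zero_add, ← add_assoc]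
          abel
      · rw [firstWord_of_not_absorbs K hu, hΓ.firstWord_sub_consWord K]
        abel
    · rw [wordOp_add_two_single, wordOp_add_two_single, wordOp_add_two_single,
        hΓ.firstWord_sub_consWord K]
      abel

/-- The action of `A(Γ)` on the space spanned by all words. -/
noncomputable def IsGraded.action :
    Γ.GraphAlgebra K →ₐ[K] Module.End K (List (V × ℕ × ℕ) →₀ K) :=
  RingQuot.liftAlgHom K ⟨Γ.freeAction K, (hΓ.isFactorFamily_wordOp K).map_eq_of_rel⟩

@[simp] theorem IsGraded.action_mk (x : FreeAlgebra K E) :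
    hΓ.action K (RingQuot.mkAlgHom K (Γ.Rel K) x) = Γ.freeAction K x :=
  RingQuot.liftAlgHom_mkAlgHom_apply _ _ _ _

/-- The element `e(v, k)` of `A(Γ)`. -/
noncomputable def IsGraded.vertexCoeff (v : V) (k : ℕ) : Γ.GraphAlgebra K :=
  RingQuot.mkAlgHom K (Γ.Rel K) (coeffRec K (hΓ.exists_isPath_bot v).choose k)

theorem IsGraded.mk_coeffRec {v : V} {π : List E} (h : Γ.IsPath v π ⊥) (k : ℕ) :
    RingQuot.mkAlgHom K (Γ.Rel K) (coeffRec K π k) = hΓ.vertexCoeff K v k := by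
  have h' := (hΓ.exists_isPath_bot v).choose_spec
  have l1 := h.level_eq
  have l2 := h'.level_eq
  rw [vertexCoeff]
  rcases Nat.eq_zero_or_pos k with rfl | hk
  · simp
  rcases le_or_gt k π.length with hk' | hk'
  · refine RingQuot.mkAlgHom_rel K ⟨v, ⊥, π, _, k, h, h', hk, hk', ?_, ?_⟩
    · rw [pathCoeff_eq_coeffRec K _ _ hk']
    · rw [pathCoeff_eq_coeffRec K _ _ (by omega)]
  · rw [coeffRec_of_length_lt K _ _ hk', coeffRec_of_length_lt K _ _ (by omega)]

theorem IsGraded.vertexCoeff_of_level_lt {v : V} {k : ℕ} (h : Γ.level v < k) :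
    hΓ.vertexCoeff K v k = 0 := by
  have h' := (hΓ.exists_isPath_bot v).choose_spec.level_eq
  rw [hΓ.level_bot] at h'
  rw [vertexCoeff, coeffRec_of_length_lt K _ _ (by omega), map_zero]

theorem IsGraded.isFactorFamily_vertexCoeff :
    Γ.IsFactorFamily K (RingQuot.mkAlgHom K (Γ.Rel K)) (hΓ.vertexCoeff K) where
  zero v := by simp [vertexCoeff]
  edge e k := by
    have h := (hΓ.exists_isPath_bot (Γ.head e)).choose_spec
    have h' : Γ.IsPath (Γ.tail e) (e :: _) ⊥ := ⟨rfl, h⟩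
    rw [← hΓ.mk_coeffRec K h', coeffRec_cons_succ, map_sub, map_mul]
    rfl

theorem IsGraded.action_vertexCoeff (v : V) (k : ℕ) :
    hΓ.action K (hΓ.vertexCoeff K v k) = Γ.wordOp K v k := by
  rw [vertexCoeff, action_mk]
  exact (hΓ.isFactorFamily_wordOp K).map_coeffRec (hΓ.exists_isPath_bot v).choose_spec
    (hΓ.wordOp_bot K) k

/-- The element of `A(Γ)` corresponding to a letter. -/
noncomputable def IsGraded.letter (v : V) (k : ℕ) (j : ℕ) : Γ.GraphAlgebra K :=
  -- The recursion solves `∑_{l ≤ j} e(v, j - l) * letter v k l = e(v, k + j + 1)`, using `e(v, 0) =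
  -- 1`.
  hΓ.vertexCoeff K v (k + j + 1) -
    ∑ l : Fin j, hΓ.vertexCoeff K v (j - l) * IsGraded.letter v k l
termination_by j
decreasing_by exact l.2

theorem IsGraded.letter_eq (v : V) (k j : ℕ) :
    hΓ.letter K v k j = hΓ.vertexCoeff K v (k + j + 1) -
      ∑ l ∈ Finset.range j, hΓ.vertexCoeff K v (j - l) * hΓ.letter K v k l := by
  rw [letter, Finset.sum_range fun l => hΓ.vertexCoeff K v (j - l) * hΓ.letter K v k l]

/-- For `v = x` this is the recursion defining `letter`. Going up one edge multiplies the series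
from the left by `1 - e s`, which uses the identities for `m` and `m - 1` and so raises the
threshold by one. -/
theorem IsGraded.sum_vertexCoeff_mul_letter {x v : V} (hxv : x ≤ v) (k m : ℕ)
    (hm : Γ.level v ≤ m + Γ.level x) :
    ∑ l ∈ Finset.range (m + 1), hΓ.vertexCoeff K v (m - l) * hΓ.letter K x k l =
      hΓ.vertexCoeff K v (k + m + 1) := by
  induction hd : Γ.level v generalizing v m with
  | zero =>
    have : x = v := by
      by_contra h
      have := hΓ.level_strictMono (lt_of_le_of_ne hxv h)
      omega
    subst this
    rw [Finset.sum_range_succ, hΓ.letter_eq K x k m]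
    simp [(hΓ.isFactorFamily_vertexCoeff K).zero]
  | succ d ih =>
    rcases hxv.eq_or_lt with rfl | hlt
    · rw [Finset.sum_range_succ, hΓ.letter_eq K x k m]
      simp [(hΓ.isFactorFamily_vertexCoeff K).zero]
    · obtain ⟨e, rfl, hxe⟩ := hΓ.exists_edge hlt
      have hl := Γ.level_tail e
      have := hΓ.level_strictMono.monotone hxe
      obtain ⟨m, rfl⟩ : ∃ m', m = m' + 1 := ⟨m - 1, by omega⟩
      have h1 := ih hxe (m + 1) (by omega) (by omega)
      have h2 := ih hxe m (by omega) (by omega)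
      have hedge := (hΓ.isFactorFamily_vertexCoeff K).edge e
      rw [hedge, show k + (m + 1) = k + m + 1 by ring, ← h2,
        show k + m + 1 + 1 = k + (m + 1) + 1 by ring, ← h1, Finset.sum_range_succ,
        Finset.sum_range_succ _ (m + 1), Finset.mul_sum, add_sub_right_comm,
        ← Finset.sum_sub_distrib]
      congr 1
      · refine Finset.sum_congr rfl fun l hl => ?_
        rw [show m + 1 - l = m - l + 1 by have := Finset.mem_range.1 hl; omega, hedge, sub_mul,
          mul_assoc]
      · simp [(hΓ.isFactorFamily_vertexCoeff K).zero]

/-- The product of the letters of a word. -/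
noncomputable def IsGraded.wordProd : List (V × ℕ × ℕ) → Γ.GraphAlgebra K
  | [] => 1
  | (v, k, j) :: u => hΓ.letter K v k j * IsGraded.wordProd u

/-- The linear map which multiplies the letters of words. -/
noncomputable def IsGraded.evalWords : (List (V × ℕ × ℕ) →₀ K) →ₗ[K] Γ.GraphAlgebra K :=
  Finsupp.linearCombination K (hΓ.wordProd K)

theorem IsGraded.evalWords_single (u : List (V × ℕ × ℕ)) :
    hΓ.evalWords K (Finsupp.single u 1) = hΓ.wordProd K u := by
  simp [evalWords]

theorem IsGraded.evalWords_consWord (v : V) (k : ℕ) (u : List (V × ℕ × ℕ)) :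
    hΓ.evalWords K (Γ.consWord K v k u) = hΓ.vertexCoeff K v (k + 1) * hΓ.wordProd K u := by
  rcases lt_or_ge k (Γ.level v) with h | h
  · rw [consWord_of_lt K h, evalWords_single, wordProd, letter_eq]
    simp
  · rw [consWord_of_le K h, map_zero, hΓ.vertexCoeff_of_level_lt K (by omega), zero_mul]

theorem IsGraded.evalWords_firstWord (v : V) (u : List (V × ℕ × ℕ)) :
    hΓ.evalWords K (Γ.firstWord K v u) = hΓ.vertexCoeff K v 1 * hΓ.wordProd K u := by
  by_cases hu : Γ.Absorbs v u
  · rcases u with _ | ⟨⟨x, k, j⟩, u⟩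
    · exact hu.elim
    · have h := hΓ.sum_vertexCoeff_mul_letter K hu.2.1 k (j + 1) (by have := hu.2.2; omega)
      rw [Finset.sum_range_succ, Finset.sum_range_succ, Nat.sub_self,
        (hΓ.isFactorFamily_vertexCoeff K).zero, one_mul, Nat.add_sub_cancel_left] at h
      rw [firstWord_of_absorbs K hu, map_sub, map_sub, map_sum, evalWords_consWord,
        evalWords_single, wordProd, wordProd, show k + j + 1 + 1 = k + (j + 1) + 1 by ring, ← h]
      simp only [evalWords_consWord, wordProd, ← mul_assoc, add_mul, Finset.sum_mul]
      rw [Finset.sum_congr rfl fun l hl => by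
        rw [show j + 1 - l = j - l + 1 by have := Finset.mem_range.1 hl; omega]]
      abel
  · rw [firstWord_of_not_absorbs K hu, evalWords_consWord]

/-- The rewriting rule is a true identity in `A(Γ)`, so evaluation turns the action into left
multiplication. Consequently `evalWords` is a left inverse of `expand`. -/
theorem IsGraded.evalWords_action (a : Γ.GraphAlgebra K) (m : List (V × ℕ × ℕ) →₀ K) :
    hΓ.evalWords K (hΓ.action K a m) = a * hΓ.evalWords K m := by
  obtain ⟨x, rfl⟩ := RingQuot.mkAlgHom_surjective K (Γ.Rel K) a
  rw [action_mk]
  induction x using FreeAlgebra.induction generalizing m with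
  | grade0 r => simp [Algebra.smul_def]
  | grade1 e =>
    induction m using Finsupp.induction_linear with
    | zero => simp
    | add f g hf hg => rw [map_add, map_add, map_add, mul_add, hf, hg]
    | single u c =>
      have h1 : Finsupp.single u c = c • Finsupp.single u (1 : K) := by simp
      have hedge := (hΓ.isFactorFamily_vertexCoeff K).edge e 0
      rw [(hΓ.isFactorFamily_vertexCoeff K).zero, mul_one, zero_add] at hedge
      rw [h1, map_smul, map_smul, map_smul, mul_smul_comm, freeAction, FreeAlgebra.lift_ι_apply,
        LinearMap.sub_apply, wordOp_one_single, wordOp_one_single, map_sub, evalWords_firstWord,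
        evalWords_firstWord, hedge, evalWords_single, ← sub_mul, sub_sub_cancel]
  | mul x y hx hy => rw [map_mul, map_mul, Module.End.mul_apply, hx, hy, mul_assoc]
  | add x y hx hy => rw [map_add, map_add, LinearMap.add_apply, map_add, hx, hy, add_mul]

/-- The expansion of an element of `A(Γ)` as a linear combination of words. -/
noncomputable def IsGraded.expand : Γ.GraphAlgebra K →ₗ[K] (List (V × ℕ × ℕ) →₀ K) :=
  (LinearMap.applyₗ (Finsupp.single [] 1)).comp (hΓ.action K).toLinearMap

theorem IsGraded.expand_apply (a : Γ.GraphAlgebra K) :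
    hΓ.expand K a = hΓ.action K a (Finsupp.single [] 1) := rfl

theorem IsGraded.evalWords_expand (a : Γ.GraphAlgebra K) :
    hΓ.evalWords K (hΓ.expand K a) = a := by
  rw [expand_apply, evalWords_action, evalWords_single, wordProd, mul_one]

/-- The terms subtracted in `firstWord` match those in the recursion for `letter`; everything
cancels except the word with the new letter in front. -/
theorem IsGraded.action_letter {v : V} {k : ℕ} (j : ℕ) {u : List (V × ℕ × ℕ)}
    (hk : k < Γ.level v) (hu : ¬ (k = 0 ∧ Γ.Absorbs v u)) :
    hΓ.action K (hΓ.letter K v k j) (Finsupp.single u 1) = Finsupp.single ((v, k, j) :: u) 1 := by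
  induction j using Nat.strong_induction_on with
  | _ j ih =>
    have hsum : ∀ i ≤ j, hΓ.action K
        (∑ l ∈ Finset.range i, hΓ.vertexCoeff K v (j - l) * hΓ.letter K v k l)
          (Finsupp.single u 1) =
        ∑ l ∈ Finset.range i, Γ.wordOp K v (j - l) (Finsupp.single ((v, k, l) :: u) 1) := by
      intro i hi
      rw [map_sum, LinearMap.sum_apply]
      refine Finset.sum_congr rfl fun l hl => ?_
      rw [map_mul, Module.End.mul_apply, ih l ((Finset.mem_range.1 hl).trans_le hi),
        action_vertexCoeff]
    rw [letter_eq, map_sub, LinearMap.sub_apply, hsum j le_rfl, action_vertexCoeff]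
    rcases j with _ | j
    · rw [Finset.range_zero, Finset.sum_empty, sub_zero, add_zero, ← consWord_of_lt K hk]
      rcases Nat.eq_zero_or_pos k with rfl | hk0
      · rw [wordOp_one_single, firstWord_of_not_absorbs]
        exact fun h => hu ⟨rfl, h⟩
      · exact wordOp_of_pos K v hk0 u
    · rw [Finset.sum_range_succ, Nat.add_sub_cancel_left, wordOp_one_single,
        firstWord_of_absorbs K ⟨by omega, le_rfl, by omega⟩, ← add_assoc, wordOp_add_two_single,
        Finset.sum_congr rfl fun l hl => by
          rw [show j + 1 - l = (j - l) + 1 by have := Finset.mem_range.1 hl; omega,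
            wordOp_of_pos K v (by have := Finset.mem_range.1 hl; omega)]]
      abel

theorem IsGraded.expand_wordProd {u : List (V × ℕ × ℕ)} (hu : Γ.IsNormalWord u) :
    hΓ.expand K (hΓ.wordProd K u) = Finsupp.single u 1 := by
  induction u with
  | nil => simp [expand_apply, wordProd]
  | cons a u ih =>
    obtain ⟨v, k, j⟩ := a
    obtain ⟨hk, h0, hu⟩ := hu
    rw [expand_apply, wordProd, map_mul, Module.End.mul_apply, ← expand_apply, ih hu,
      hΓ.action_letter K j hk h0]

end Bot

end Words

end LayeredGraph

namespace LayeredGraph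

/-! ### Graded components and normal words. -/

section Grading

variable {V E : Type*} {Γ : LayeredGraph V E} (K : Type*) [Field K]

theorem mul_mem_component {i j : ℕ} {a b : Γ.GraphAlgebra K} (ha : a ∈ Γ.component K i)
    (hb : b ∈ Γ.component K j) : a * b ∈ Γ.component K (i + j) := by
  obtain ⟨x, hx, rfl⟩ := ha
  obtain ⟨y, hy, rfl⟩ := hb
  refine ⟨x * y, ?_, map_mul (RingQuot.mkAlgHom K (Γ.Rel K)) x y⟩
  rw [pow_add]
  exact Submodule.mul_mem_mul hx hy

variable [PartialOrder V]

variable (Γ) in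
/-- The span of the normal words of degree `i`. -/
noncomputable def normalSpan (i : ℕ) : Submodule K (List (V × ℕ × ℕ) →₀ K) :=
  Finsupp.supported K K {u | Γ.IsNormalWord u ∧ wordDegree u = i}

theorem single_mem_normalSpan {i : ℕ} {u : List (V × ℕ × ℕ)} (hu : Γ.IsNormalWord u)
    (hi : wordDegree u = i) : Finsupp.single u 1 ∈ Γ.normalSpan K i :=
  Finsupp.single_mem_supported K 1 ⟨hu, hi⟩

theorem consWord_mem_normalSpan (v : V) {k i : ℕ} {u : List (V × ℕ × ℕ)} (hu : Γ.IsNormalWord u)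
    (h0 : ¬ (k = 0 ∧ Γ.Absorbs v u)) (hi : k + 1 + wordDegree u = i) :
    Γ.consWord K v k u ∈ Γ.normalSpan K i := by
  rcases lt_or_ge k (Γ.level v) with h | h
  · rw [consWord_of_lt K h]
    exact single_mem_normalSpan K ⟨h, h0, hu⟩ hi
  · rw [consWord_of_le K h]
    exact zero_mem _

/-- Changing the index `j` of the first letter preserves normality, and the letters put in front by
the rewriting have positive second entry, so no absorption condition applies to them. -/
theorem firstWord_mem_normalSpan (v : V) {i : ℕ} {u : List (V × ℕ × ℕ)} (hu : Γ.IsNormalWord u)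
    (hi : wordDegree u = i) : Γ.firstWord K v u ∈ Γ.normalSpan K (i + 1) := by
  by_cases h : Γ.Absorbs v u
  · rcases u with _ | ⟨⟨x, k, j⟩, u⟩
    · exact h.elim
    · have hd : ∀ l, wordDegree ((x, k, l) :: u) = k + 1 + l + wordDegree u := fun l => rfl
      rw [hd] at hi
      obtain ⟨hk, h0, hu'⟩ := hu
      have hu : ∀ l, Γ.IsNormalWord ((x, k, l) :: u) := fun l => ⟨hk, h0, hu'⟩
      rw [firstWord_of_absorbs K h]
      refine sub_mem (sub_mem ?_ ?_) (sum_mem fun l hl => ?_)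
      · exact consWord_mem_normalSpan K v hu' (by omega) (by omega)
      · exact single_mem_normalSpan K (hu _) (by rw [hd]; omega)
      · have := Finset.mem_range.1 hl
        exact consWord_mem_normalSpan K v (hu _) (by omega) (by rw [hd]; omega)
  · rw [firstWord_of_not_absorbs K h]
    exact consWord_mem_normalSpan K v hu (by tauto) (by omega)

theorem wordOp_one_mem_normalSpan (v : V) {i : ℕ} {m : List (V × ℕ × ℕ) →₀ K}
    (hm : m ∈ Γ.normalSpan K i) : Γ.wordOp K v 1 m ∈ Γ.normalSpan K (i + 1) := by
  rw [wordOp, Finsupp.linearCombination_apply]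
  exact sum_mem fun u hu => Submodule.smul_mem _ _
    (firstWord_mem_normalSpan K v (hm hu).1 (hm hu).2)

theorem freeAction_mem_normalSpan (i j : ℕ) {x : FreeAlgebra K E}
    (hx : x ∈ (Submodule.span K (Set.range (FreeAlgebra.ι K : E → FreeAlgebra K E))) ^ i)
    {m : List (V × ℕ × ℕ) →₀ K} (hm : m ∈ Γ.normalSpan K j) :
    Γ.freeAction K x m ∈ Γ.normalSpan K (j + i) := by
  induction i generalizing x with
  | zero =>
    rw [pow_zero] at hx
    obtain ⟨r, rfl⟩ := Submodule.mem_one.1 hx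
    rw [AlgHom.commutes, Module.algebraMap_end_apply]
    exact Submodule.smul_mem _ _ hm
  | succ i ih =>
    rw [pow_succ'] at hx
    induction hx using Submodule.mul_induction_on' with
    | mem_mul_mem y hy z hz =>
      rw [map_mul, Module.End.mul_apply, ← add_assoc]
      have hz' := ih hz
      induction hy using Submodule.span_induction with
      | mem y hy =>
        obtain ⟨e, rfl⟩ := hy
        rw [freeAction, FreeAlgebra.lift_ι_apply]
        exact sub_mem (wordOp_one_mem_normalSpan K _ hz') (wordOp_one_mem_normalSpan K _ hz')
      | zero => simp
      | add a b _ _ ha hb =>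
        rw [map_add, LinearMap.add_apply]
        exact add_mem ha hb
      | smul c a _ ha =>
        rw [map_smul, LinearMap.smul_apply]
        exact Submodule.smul_mem _ _ ha
    | add a _ b _ ha hb =>
      rw [map_add, LinearMap.add_apply]
      exact add_mem ha hb

variable [OrderBot V] (hΓ : Γ.IsGraded)
include hΓ

theorem IsGraded.vertexCoeff_mem (v : V) (k : ℕ) : hΓ.vertexCoeff K v k ∈ Γ.component K k :=
  ⟨_, coeffRec_mem K _ k, rfl⟩

theorem IsGraded.letter_mem (v : V) (k j : ℕ) :
    hΓ.letter K v k j ∈ Γ.component K (k + 1 + j) := by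
  induction j using Nat.strong_induction_on with
  | _ j ih =>
    rw [letter_eq]
    refine sub_mem ?_ (sum_mem fun l hl => ?_)
    · rw [add_right_comm]
      exact hΓ.vertexCoeff_mem K _ _
    · rw [Finset.mem_range] at hl
      have := mul_mem_component K (hΓ.vertexCoeff_mem K v (j - l)) (ih l hl)
      rwa [show j - l + (k + 1 + l) = k + 1 + j by omega] at this

theorem IsGraded.wordProd_mem (u : List (V × ℕ × ℕ)) :
    hΓ.wordProd K u ∈ Γ.component K (wordDegree u) := by
  induction u with
  | nil =>
    refine ⟨1, ?_, map_one (RingQuot.mkAlgHom K (Γ.Rel K))⟩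
    rw [wordDegree, pow_zero]
    exact Submodule.one_le.1 le_rfl
  | cons a u ih =>
    obtain ⟨v, k, j⟩ := a
    exact mul_mem_component K (hΓ.letter_mem K v k j) ih

theorem IsGraded.map_expand_component (i : ℕ) :
    (Γ.component K i).map (hΓ.expand K) = Γ.normalSpan K i := by
  apply le_antisymm
  · rintro _ ⟨_, ⟨x, hx, rfl⟩, rfl⟩
    rw [expand_apply, AlgHom.toLinearMap_apply, action_mk, ← zero_add i]
    exact freeAction_mem_normalSpan K i 0 hx (single_mem_normalSpan K trivial rfl)
  · rw [normalSpan, Finsupp.supported_eq_span_single, Submodule.span_le]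
    rintro _ ⟨u, ⟨hu, rfl⟩, rfl⟩
    exact ⟨_, hΓ.wordProd_mem K u, hΓ.expand_wordProd K hu⟩

theorem IsGraded.finrank_component (i : ℕ) :
    Module.finrank K (Γ.component K i) =
      Nat.card {u : {u // Γ.IsNormalWord u} // wordDegree u.1 = i} := by
  have hinj : Function.Injective (hΓ.expand K) :=
    Function.LeftInverse.injective (hΓ.evalWords_expand K)
  rw [(Submodule.equivMapOfInjective _ hinj (Γ.component K i)).finrank_eq,
    hΓ.map_expand_component K, normalSpan, (Finsupp.supportedEquivFinsupp _).finrank_eq,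
    Module.finrank_eq_nat_card_basis (Finsupp.basisSingleOne (R := K)),
    Nat.card_congr (Equiv.subtypeSubtypeEquivSubtypeInter Γ.IsNormalWord
      (fun u => wordDegree u = i))]
  rfl

end Grading

end LayeredGraph

/-! ### Generating series of graded sets. -/

/-- The power series whose `i`-th coefficient is the number of elements of degree `i`. -/
noncomputable def degreeSeries {α : Type*} (d : α → ℕ) : PowerSeries ℚ :=
  PowerSeries.mk fun i => (Nat.card {a // d a = i} : ℚ)

theorem degreeSeries_congr {α β : Type*} {d : α → ℕ} {d' : β → ℕ} (e : α ≃ β)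
    (h : ∀ a, d' (e a) = d a) : degreeSeries d = degreeSeries d' := by
  ext i
  rw [degreeSeries, degreeSeries, PowerSeries.coeff_mk, PowerSeries.coeff_mk,
    Nat.card_congr (e.subtypeEquiv (p := fun a => d a = i) (q := fun b => d' b = i)
      fun a => by rw [h])]

theorem degreeSeries_sigma {ι : Type*} [Fintype ι] {α : ι → Type*} (d : ∀ i, α i → ℕ)
    (hd : ∀ i m, Finite {a // d i a = m}) :
    degreeSeries (fun p : Σ i, α i => d p.1 p.2) = ∑ i, degreeSeries (d i) := by
  ext m
  rw [map_sum]
  simp only [degreeSeries, PowerSeries.coeff_mk]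
  have e : {p : Σ i, α i // d p.1 p.2 = m} ≃ Σ i, {a : α i // d i a = m} :=
    { toFun := fun p => ⟨p.1.1, p.1.2, p.2⟩
      invFun := fun p => ⟨⟨p.1, p.2.1⟩, p.2.2⟩
      left_inv := fun _ => rfl
      right_inv := fun _ => rfl }
  rw [Nat.card_congr e, Nat.card_sigma, Nat.cast_sum]

theorem degreeSeries_option {α : Type*} (d : α → ℕ) (hd : ∀ m, Finite {a // d a = m}) :
    degreeSeries (fun a : Option α => a.elim 0 d) = 1 + degreeSeries d := by
  ext m
  rw [map_add, PowerSeries.coeff_one]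
  simp only [degreeSeries, PowerSeries.coeff_mk]
  have e : {a : Option α // a.elim 0 d = m} ≃ {_u : Unit // 0 = m} ⊕ {a // d a = m} :=
    { toFun := fun a => match a with
        | ⟨none, h⟩ => Sum.inl ⟨(), h⟩
        | ⟨some a, h⟩ => Sum.inr ⟨a, h⟩
      invFun := fun a => match a with
        | Sum.inl a => ⟨none, a.2⟩
        | Sum.inr a => ⟨some a.1, a.2⟩
      left_inv := by rintro ⟨_ | a, h⟩ <;> rfl
      right_inv := by rintro (a | a) <;> rfl }
  rw [Nat.card_congr e, Nat.card_sum, Nat.cast_add]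
  congr 1
  split_ifs with h
  · subst h
    simp
  · have : IsEmpty {_u : Unit // 0 = m} := ⟨fun a => h a.2.symm⟩
    simp

theorem degreeSeries_add {α : Type*} (d : α → ℕ) (c : ℕ) :
    degreeSeries (fun a => d a + c) = PowerSeries.X ^ c * degreeSeries d := by
  ext m
  rw [PowerSeries.coeff_X_pow_mul']
  simp only [degreeSeries, PowerSeries.coeff_mk]
  split_ifs with h
  · rw [Nat.card_congr (Equiv.subtypeEquivRight fun a => ?_)]
    omega
  · have : IsEmpty {a // d a + c = m} := ⟨fun a => h (by have := a.2; omega)⟩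
    simp

namespace LayeredGraph

/-! ### Counting normal words by their first vertex. -/

section Counting

variable {V E : Type*} (Γ : LayeredGraph V E)

theorem finite_wordDegree_eq [Finite V] (m : ℕ) :
    {u : List (V × ℕ × ℕ) | wordDegree u = m}.Finite := by
  induction m using Nat.strong_induction_on with
  | _ m ih =>
    have hs : (Set.univ ×ˢ (Set.Iic m ×ˢ Set.Iic m) : Set (V × ℕ × ℕ)).Finite :=
      Set.finite_univ.prod ((Set.finite_Iic m).prod (Set.finite_Iic m))
    have ht : (⋃ i ∈ Set.Iio m, {u : List (V × ℕ × ℕ) | wordDegree u = i}).Finite :=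
      (Set.finite_Iio m).biUnion fun i hi => ih i hi
    refine ((Set.finite_singleton []).union (hs.image2 List.cons ht)).subset ?_
    rintro (_ | ⟨⟨v, k, j⟩, u⟩) hu
    · exact Or.inl rfl
    · have hu : k + 1 + j + wordDegree u = m := hu
      refine Or.inr ⟨(v, k, j), ⟨trivial, show k ≤ m by omega, show j ≤ m by omega⟩, u, ?_, rfl⟩
      · simp only [Set.mem_iUnion]
        exact ⟨wordDegree u, Set.mem_Iio.2 (by omega), rfl⟩

theorem finite_subtype_wordDegree_eq [Finite V] (p : List (V × ℕ × ℕ) → Prop) (m : ℕ) :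
    Finite {u : {u // p u} // wordDegree u.1 = m} :=
  have : Finite {u : List (V × ℕ × ℕ) // wordDegree u = m} := finite_wordDegree_eq m
  Finite.of_injective (β := {u : List (V × ℕ × ℕ) // wordDegree u = m})
    (fun u => ⟨u.1.1, u.2⟩) fun _ _ h => Subtype.ext (Subtype.ext (Subtype.mk.inj h))

variable [PartialOrder V]

/-- The normal words whose first letter has the vertex `x`. -/
def IsNormalAt (x : V) : List (V × ℕ × ℕ) → Prop
  | [] => False
  | a :: u => a.1 = x ∧ Γ.IsNormalWord (a :: u)

/-- The generating series of the normal words whose first letter has the vertex `x`. -/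
noncomputable def vertexSeries (x : V) : PowerSeries ℚ :=
  degreeSeries fun u : {u // Γ.IsNormalAt x u} => wordDegree u.1

variable {Γ}

theorem IsGraded.hilbertSeries_eq [OrderBot V] (hΓ : Γ.IsGraded) (K : Type*) [Field K] :
    Γ.hilbertSeries K = degreeSeries fun u : {u // Γ.IsNormalWord u} => wordDegree u.1 := by
  ext i
  rw [hilbertSeries, degreeSeries, PowerSeries.coeff_mk, PowerSeries.coeff_mk,
    hΓ.finrank_component K]

/-- A nonempty normal word is a normal word with a certain first vertex. -/
def normalWordEquiv : {u // Γ.IsNormalWord u} ≃ Option (Σ x, {u // Γ.IsNormalAt x u}) where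
  toFun u := match u with
    | ⟨[], _⟩ => none
    | ⟨a :: u, h⟩ => some ⟨a.1, a :: u, rfl, h⟩
  invFun u := match u with
    | none => ⟨[], trivial⟩
    | some ⟨_, a :: u, h⟩ => ⟨a :: u, h.2⟩
  left_inv := by rintro ⟨_ | ⟨a, u⟩, h⟩ <;> rfl
  right_inv := by
    rintro (_ | ⟨x, _ | ⟨a, u⟩, h⟩)
    · rfl
    · exact h.elim
    · obtain ⟨rfl, h⟩ := h
      rfl

theorem degreeSeries_normalWord [Fintype V] :
    (degreeSeries fun u : {u // Γ.IsNormalWord u} => wordDegree u.1) =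
      1 + ∑ x, Γ.vertexSeries x := by
  rw [degreeSeries_congr (d' := fun a => a.elim 0 fun p => wordDegree p.2.1) normalWordEquiv,
    degreeSeries_option, degreeSeries_sigma fun x (u : {u // Γ.IsNormalAt x u}) => wordDegree u.1]
  · rfl
  · exact fun x => finite_subtype_wordDegree_eq _
  · intro m
    have : Finite {u : {u // Γ.IsNormalWord u} // wordDegree u.1 = m} :=
      finite_subtype_wordDegree_eq _ m
    refine Finite.of_injective (β := {u : {u // Γ.IsNormalWord u} // wordDegree u.1 = m})
      (fun p => ⟨normalWordEquiv.symm (some p.1), ?_⟩) ?_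
    · obtain ⟨⟨x, _ | ⟨a, u⟩, h⟩, hp⟩ := p
      · exact h.elim
      · exact hp
    · intro p p' h
      have := normalWordEquiv.symm.injective (congrArg Subtype.val h)
      exact Subtype.ext (Option.some_injective _ this)
  · rintro ⟨_ | ⟨a, u⟩, h⟩ <;> rfl

open Classical in
/-- The shape of the leading word of `e(v, k + 1) u` when this is expressed by words with first
vertex at most `v`. -/
noncomputable def attach (Γ : LayeredGraph V E) (v : V) (k : ℕ) (u : List (V × ℕ × ℕ)) :
    List (V × ℕ × ℕ) :=
  match u with
  | [] => [(v, k, 0)]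
  -- Absorption means `j ≥ level v - level x - 1`. Subtracting this bound makes the new index run
  -- through all of `ℕ` when `x < v`, and through the positive integers when `x = v`.
  | (x, κ, j) :: u => if k = 0 ∧ Γ.Absorbs v ((x, κ, j) :: u) then
      (x, κ, j + 1 + Γ.level x - Γ.level v) :: u else (v, k, 0) :: (x, κ, j) :: u

theorem attach_of_not {v : V} {k : ℕ} {u : List (V × ℕ × ℕ)} (h : ¬ (k = 0 ∧ Γ.Absorbs v u)) :
    Γ.attach v k u = (v, k, 0) :: u := by
  rcases u with _ | ⟨⟨x, κ, j⟩, u⟩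
  · rw [attach]
  · rw [attach, if_neg h]

theorem attach_zero {v x : V} {κ j : ℕ} {u : List (V × ℕ × ℕ)}
    (h : Γ.Absorbs v ((x, κ, j) :: u)) :
    Γ.attach v 0 ((x, κ, j) :: u) = (x, κ, j + 1 + Γ.level x - Γ.level v) :: u := by
  rw [attach, if_pos ⟨rfl, h⟩]

/-- `attach` as a map to the normal words with first vertex at most `v`. -/
theorem exists_isNormalAt_attach {v : V} {k : ℕ} (hk : k < Γ.level v) {u : List (V × ℕ × ℕ)}
    (hu : Γ.IsNormalWord u) (hmono : ∀ x ≤ v, Γ.level x ≤ Γ.level v) :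
    ∃ x ≤ v, Γ.IsNormalAt x (Γ.attach v k u) ∧
      wordDegree (Γ.attach v k u) + (Γ.level v - Γ.level x) = wordDegree u + (k + 1) := by
  by_cases h : k = 0 ∧ Γ.Absorbs v u
  · rcases u with _ | ⟨⟨x, κ, j⟩, u⟩
    · exact h.2.elim
    · obtain ⟨rfl, h⟩ := h
      refine ⟨x, h.2.1, ?_, ?_⟩
      · rw [attach_zero h]
        exact ⟨rfl, hu⟩
      · rw [attach_zero h]
        have := h.2.2
        have := hmono x h.2.1
        simp only [wordDegree]
        omega
  · refine ⟨v, le_rfl, ?_, ?_⟩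
    · rw [attach_of_not h]
      exact ⟨rfl, hk, h, hu⟩
    · rw [attach_of_not h]
      simp only [wordDegree]
      omega

theorem attach_injective {v : V} {k k' : ℕ} {u u' : List (V × ℕ × ℕ)}
    (hmono : ∀ x < v, Γ.level x < Γ.level v)
    (h : Γ.attach v k u = Γ.attach v k' u') : k = k' ∧ u = u' := by
  -- If `x = v`, the new index is `j + 1`, which is never the `0` of a freshly prefixed letter.
  have key : ∀ {x : V} {κ j k : ℕ} {u u' : List (V × ℕ × ℕ)}, Γ.Absorbs v ((x, κ, j) :: u) →
      (x, κ, j + 1 + Γ.level x - Γ.level v) :: u ≠ (v, k, 0) :: u' := by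
    intro x κ j k u u' h heq
    simp only [List.cons.injEq, Prod.mk.injEq] at heq
    obtain ⟨⟨rfl, -, h0⟩, -⟩ := heq
    omega
  by_cases h1 : k = 0 ∧ Γ.Absorbs v u <;> by_cases h2 : k' = 0 ∧ Γ.Absorbs v u'
  · obtain ⟨rfl, h1⟩ := h1
    obtain ⟨rfl, h2⟩ := h2
    rcases u with _ | ⟨⟨x, κ, j⟩, u⟩
    · exact h1.elim
    rcases u' with _ | ⟨⟨x', κ', j'⟩, u'⟩
    · exact h2.elim
    rw [attach_zero h1, attach_zero h2] at h
    simp only [List.cons.injEq, Prod.mk.injEq] at h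
    obtain ⟨⟨rfl, rfl, h0⟩, rfl⟩ := h
    have := h1.2.2
    have := h2.2.2
    obtain rfl : j = j' := by omega
    exact ⟨rfl, rfl⟩
  · obtain ⟨rfl, h1⟩ := h1
    rcases u with _ | ⟨⟨x, κ, j⟩, u⟩
    · exact h1.elim
    rw [attach_zero h1, attach_of_not h2] at h
    exact (key h1 h).elim
  · obtain ⟨rfl, h2⟩ := h2
    rcases u' with _ | ⟨⟨x, κ, j⟩, u'⟩
    · exact h2.elim
    rw [attach_zero h2, attach_of_not h1] at h
    exact (key h2 h.symm).elim
  · rw [attach_of_not h1, attach_of_not h2] at h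
    simp only [List.cons.injEq, Prod.mk.injEq] at h
    exact ⟨h.1.2.1, h.2⟩

theorem exists_attach_eq {v x : V} (hxv : x ≤ v) (hmono : ∀ x < v, Γ.level x < Γ.level v)
    {w : List (V × ℕ × ℕ)} (hw : Γ.IsNormalAt x w) :
    ∃ k < Γ.level v, ∃ u, Γ.IsNormalWord u ∧ Γ.attach v k u = w := by
  rcases w with _ | ⟨⟨y, κ, j⟩, w⟩
  · exact hw.elim
  obtain ⟨h, hκ, h0, hw⟩ := hw
  obtain rfl : y = x := h
  by_cases hc : y = v ∧ j = 0
  · obtain ⟨rfl, rfl⟩ := hc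
    exact ⟨κ, hκ, w, hw, attach_of_not h0⟩
  · have hlt : y = v ∧ 0 < j ∨ Γ.level y < Γ.level v := by
      rcases hxv.eq_or_lt with rfl | h
      · exact Or.inl ⟨rfl, Nat.pos_of_ne_zero fun h => hc ⟨rfl, h⟩⟩
      · exact Or.inr (hmono _ h)
    have hle : Γ.level y ≤ Γ.level v ∧ Γ.level y + 1 ≤ j + Γ.level v := by
      rcases hlt with ⟨rfl, h⟩ | h <;> omega
    -- The index is chosen to undo the shift made by `attach`.
    have hab : Γ.Absorbs v ((y, κ, j + Γ.level v - 1 - Γ.level y) :: w) :=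
      ⟨by omega, hxv, by omega⟩
    refine ⟨0, by omega, (y, κ, _) :: w, ⟨hκ, h0, hw⟩, (attach_zero hab).trans ?_⟩
    congr 3
    omega

/-- The map `attach` is a bijection from pairs of `k < level v` and a normal word onto the normal
words with first vertex `x ≤ v`; the powers of `X` record its change of degree. -/
theorem IsGraded.sum_vertexSeries [OrderBot V] [Fintype V] (hΓ : Γ.IsGraded) (v : V)
    [Fintype {x // x ≤ v}] :
    ∑ x : {x // x ≤ v}, PowerSeries.X ^ (Γ.level v - Γ.level x.1) * Γ.vertexSeries x.1 =
      (∑ k ∈ Finset.range (Γ.level v), PowerSeries.X ^ (k + 1)) *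
        degreeSeries fun u : {u // Γ.IsNormalWord u} => wordDegree u.1 := by
  have hfin : ∀ (p : List (V × ℕ × ℕ) → Prop) (c m : ℕ),
      Finite {u : {u // p u} // wordDegree u.1 + c = m} := by
    intro p c m
    have := finite_subtype_wordDegree_eq p (m - c)
    exact Finite.of_injective (β := {u : {u // p u} // wordDegree u.1 = m - c})
      (fun u => ⟨u.1, by have := u.2; omega⟩) fun _ _ h =>
        Subtype.ext (congrArg (fun u => u.1) h)
  have hex := fun (p : Σ _ : Fin (Γ.level v), {u // Γ.IsNormalWord u}) =>
    exists_isNormalAt_attach p.1.2 p.2.2 fun x hx => hΓ.level_strictMono.monotone hx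
  choose f hfv hf hdeg using hex
  have hbij : Function.Bijective (fun p : Σ _ : Fin (Γ.level v), {u // Γ.IsNormalWord u} =>
      (⟨⟨f p, hfv p⟩, ⟨_, hf p⟩⟩ : Σ x : {x // x ≤ v}, {u // Γ.IsNormalAt x.1 u})) := by
    have hval : ∀ p p' : Σ x : {x // x ≤ v}, {u // Γ.IsNormalAt x.1 u},
        p.2.1 = p'.2.1 → p = p' := by
      rintro ⟨⟨x, hx⟩, ⟨_ | ⟨a, u⟩, h⟩⟩ ⟨⟨x', hx'⟩, ⟨_ | ⟨a', u'⟩, h'⟩⟩ heq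
      · exact h.elim
      · exact h.elim
      · exact h'.elim
      · obtain ⟨rfl, rfl⟩ := List.cons.inj heq
        obtain rfl : a.1 = x := h.1
        obtain rfl : a.1 = x' := h'.1
        rfl
    constructor
    · rintro ⟨k, u⟩ ⟨k', u'⟩ h
      obtain ⟨hk, hu⟩ := attach_injective (fun x hx => hΓ.level_strictMono hx)
        (congrArg (fun p => p.2.1) h)
      obtain rfl := Fin.ext hk
      obtain rfl := Subtype.ext hu
      rfl
    · rintro ⟨⟨x, hx⟩, ⟨w, hw⟩⟩
      obtain ⟨k, hk, u, hu, rfl⟩ :=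
        exists_attach_eq hx (fun x hx => hΓ.level_strictMono hx) hw
      exact ⟨⟨⟨k, hk⟩, ⟨u, hu⟩⟩, hval _ _ rfl⟩
  have h := degreeSeries_congr (d := fun p : Σ _ : Fin (Γ.level v), {u // Γ.IsNormalWord u} =>
      wordDegree p.2.1 + (p.1.1 + 1))
    (d' := fun p : Σ x : {x // x ≤ v}, {u // Γ.IsNormalAt x.1 u} =>
      wordDegree p.2.1 + (Γ.level v - Γ.level p.1.1)) (Equiv.ofBijective _ hbij) hdeg
  rw [degreeSeries_sigma (fun (k : Fin (Γ.level v)) (u : {u // Γ.IsNormalWord u}) =>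
      wordDegree u.1 + (k.1 + 1)) fun k m => hfin _ _ m,
    degreeSeries_sigma (fun (x : {x // x ≤ v}) (u : {u // Γ.IsNormalAt x.1 u}) =>
      wordDegree u.1 + (Γ.level v - Γ.level x.1)) fun x m => hfin _ _ m] at h
  simp only [degreeSeries_add] at h
  rw [Finset.sum_range, Finset.sum_mul, h]
  rfl

end Counting

end LayeredGraph

/-! ### Identities for `q`-binomial coefficients. -/

theorem qBinomial_zero_right (q n : ℕ) : qBinomial q n 0 = 1 := by
  simp [qBinomial]

theorem qBinomial_succ_right (q n m : ℕ) :
    qBinomial q n (m + 1) =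
      qBinomial q n m * (((q : ℚ) ^ (n - m) - 1) / ((q : ℚ) ^ (m + 1) - 1)) :=
  Finset.prod_range_succ _ _

theorem qBinomial_self_succ (q n : ℕ) : qBinomial q n (n + 1) = 0 := by
  simp [qBinomial_succ_right]

theorem pow_succ_sub_one_ne_zero {q : ℕ} (hq : 1 < q) (m : ℕ) : (q : ℚ) ^ (m + 1) - 1 ≠ 0 :=
  (sub_pos.2 (one_lt_pow₀ (by exact_mod_cast hq) m.succ_ne_zero)).ne'

theorem qBinomial_succ_succ' (q n m : ℕ) :
    qBinomial q (n + 1) (m + 1) =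
      qBinomial q n m * (((q : ℚ) ^ (n + 1) - 1) / ((q : ℚ) ^ (m + 1) - 1)) := by
  rw [qBinomial, qBinomial, Finset.prod_div_distrib, Finset.prod_div_distrib,
    Finset.prod_range_succ', Finset.prod_range_succ (fun i => (q : ℚ) ^ (i + 1) - 1)]
  simp only [Nat.add_sub_add_right, Nat.sub_zero]
  rw [mul_div_mul_comm]

/-- The `q`-Pascal rule. -/
theorem qBinomial_succ_succ {q : ℕ} (hq : 1 < q) {n m : ℕ} (h : m ≤ n) :
    qBinomial q (n + 1) (m + 1) =
      (q : ℚ) ^ (m + 1) * qBinomial q n (m + 1) + qBinomial q n m := by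
  have h0 := pow_succ_sub_one_ne_zero hq m
  have h1 : (q : ℚ) ^ (n + 1) = q ^ (m + 1) * q ^ (n - m) := by
    rw [← pow_add]
    congr 1
    omega
  rw [qBinomial_succ_succ', qBinomial_succ_right, h1]
  field_simp
  ring

/-- The factorial form of the `q`-binomial coefficient, from which its symmetry is read off. -/
theorem qBinomial_mul_prod {q : ℕ} (hq : 1 < q) {n m : ℕ} (h : m ≤ n) :
    qBinomial q n m * ((∏ i ∈ Finset.range m, ((q : ℚ) ^ (i + 1) - 1)) *
      ∏ i ∈ Finset.range (n - m), ((q : ℚ) ^ (i + 1) - 1)) =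
      ∏ i ∈ Finset.range n, ((q : ℚ) ^ (i + 1) - 1) := by
  induction m with
  | zero => simp [qBinomial_zero_right]
  | succ m ih =>
    have h0 := pow_succ_sub_one_ne_zero hq m
    rw [← ih (by omega), show n - m = n - (m + 1) + 1 by omega, Finset.prod_range_succ,
      Finset.prod_range_succ, qBinomial_succ_right, show n - m = n - (m + 1) + 1 by omega]
    field_simp

theorem qBinomial_symm {q : ℕ} (hq : 1 < q) {n m : ℕ} (h : m ≤ n) :
    qBinomial q n (n - m) = qBinomial q n m := by
  have h1 := qBinomial_mul_prod hq h
  have h2 := qBinomial_mul_prod hq (Nat.sub_le n m)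
  rw [Nat.sub_sub_self h, mul_comm (∏ i ∈ Finset.range (n - m), _), ← h1] at h2
  refine mul_right_cancel₀ (mul_ne_zero ?_ ?_) h2 <;>
    exact Finset.prod_ne_zero_iff.2 fun i _ => pow_succ_sub_one_ne_zero hq i

/-- The `q`-Pochhammer symbol `(1 - t)(1 - tq)⋯(1 - tq^(k-1))`. -/
noncomputable def qPochhammer (q k : ℕ) : PowerSeries ℚ :=
  ∏ i ∈ Finset.range k, (1 - PowerSeries.C ((q : ℚ) ^ i) * PowerSeries.X)

/-- Induction on `d`: after the `q`-Pascal rule, the `k`-th term for `d` appears with factor `q^k t`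
from one summand and `1 - q^k t` from the other, which add up to `1`. -/
theorem sum_qBinomial_mul_qPochhammer {q : ℕ} (hq : 1 < q) (d : ℕ) :
    ∑ k ∈ Finset.range (d + 1),
      PowerSeries.C (qBinomial q d k) * (PowerSeries.X ^ (d - k) * qPochhammer q k) = 1 := by
  induction d with
  | zero => simp [qBinomial_zero_right, qPochhammer]
  | succ d ih =>
    have h1 : ∀ k ∈ Finset.range (d + 1), PowerSeries.C (qBinomial q (d + 1) (k + 1)) *
        (PowerSeries.X ^ (d + 1 - (k + 1)) * qPochhammer q (k + 1)) =
        PowerSeries.C ((q : ℚ) ^ (k + 1) * qBinomial q d (k + 1)) *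
          (PowerSeries.X ^ (d + 1 - (k + 1)) * qPochhammer q (k + 1)) +
        PowerSeries.C (qBinomial q d k) * (PowerSeries.X ^ (d - k) * qPochhammer q k) *
          (1 - PowerSeries.C ((q : ℚ) ^ k) * PowerSeries.X) := by
      intro k hk
      rw [qBinomial_succ_succ hq (Finset.mem_range_succ_iff.1 hk), map_add,
        Nat.add_sub_add_right, qPochhammer, Finset.prod_range_succ, ← qPochhammer]
      ring
    have h2 : PowerSeries.C (qBinomial q (d + 1) 0) *
        (PowerSeries.X ^ (d + 1 - 0) * qPochhammer q 0) =
        PowerSeries.C ((q : ℚ) ^ 0 * qBinomial q d 0) *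
          (PowerSeries.X ^ (d + 1 - 0) * qPochhammer q 0) := by
      simp [qBinomial_zero_right]
    rw [Finset.sum_range_succ', Finset.sum_congr rfl h1, h2, Finset.sum_add_distrib,
      add_right_comm, ← Finset.sum_range_succ' (fun k =>
        PowerSeries.C ((q : ℚ) ^ k * qBinomial q d k) *
          (PowerSeries.X ^ (d + 1 - k) * qPochhammer q k)), Finset.sum_range_succ,
      qBinomial_self_succ, mul_zero, map_zero, zero_mul, add_zero, ← Finset.sum_add_distrib]
    refine Eq.trans ?_ ih
    refine Finset.sum_congr rfl fun k hk => ?_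
    rw [Nat.succ_sub (Finset.mem_range_succ_iff.1 hk), pow_succ, map_mul]
    ring

/-! ### Number of subspaces of given dimension. -/

section CountSubspaces

variable {F M : Type*} [Field F] [AddCommGroup M] [Module F M]

/-- The bases of a subspace of dimension `k`, as linearly independent families in the whole
space. -/
noncomputable def linearIndependentSpanEquiv [FiniteDimensional F M] {k : ℕ} (W : Submodule F M)
    (hW : Module.finrank F W = k) :
    {s : {s : Fin k → M // LinearIndependent F s} // Submodule.span F (Set.range s.1) = W} ≃
      {t : Fin k → W // LinearIndependent F t} where
  toFun s := ⟨fun i => ⟨s.1.1 i, s.2.le (Submodule.subset_span ⟨i, rfl⟩)⟩,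
    LinearIndependent.of_comp W.subtype s.1.2⟩
  invFun t := ⟨⟨fun i => t.1 i, t.2.map' W.subtype W.ker_subtype⟩, by
    refine Submodule.eq_of_le_of_finrank_eq (Submodule.span_le.2 ?_) ?_
    · rintro _ ⟨i, rfl⟩
      exact (t.1 i).2
    · exact (finrank_span_eq_card (t.2.map' W.subtype W.ker_subtype)).trans
        ((Fintype.card_fin k).trans hW.symm)⟩
  left_inv _ := rfl
  right_inv _ := rfl

variable [Finite F] [FiniteDimensional F M]

/-- Linearly independent `k`-tuples are counted twice: directly, and grouped by their span. -/
theorem card_submodule_mul_prod {k : ℕ} (hk : k ≤ Module.finrank F M) :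
    Nat.card {W : Submodule F M // Module.finrank F W = k} *
      ∏ i ∈ Finset.range k, (Nat.card F ^ k - Nat.card F ^ i) =
      ∏ i ∈ Finset.range k, (Nat.card F ^ Module.finrank F M - Nat.card F ^ i) := by
  have := Fintype.ofFinite F
  have : Finite M := Module.finite_of_finite F
  have := Fintype.ofFinite {W : Submodule F M // Module.finrank F W = k}
  have h := card_linearIndependent (K := F) (V := M) hk
  rw [← Nat.card_congr (Equiv.sigmaFiberEquiv
    fun s : {s : Fin k → M // LinearIndependent F s} =>
      (⟨Submodule.span F (Set.range s.1), by
        rw [finrank_span_eq_card s.2, Fintype.card_fin]⟩ :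
        {W : Submodule F M // Module.finrank F W = k})), Nat.card_sigma,
    Finset.sum_congr rfl fun W _ => by
      rw [Nat.card_congr ((Equiv.subtypeEquivRight fun s => Subtype.ext_iff).trans
        (linearIndependentSpanEquiv W.1 W.2)), card_linearIndependent W.2.ge, W.2]] at h
  rw [Finset.prod_range, Finset.prod_range, Nat.card_eq_fintype_card (α := F), ← h,
    Finset.sum_const, Finset.card_univ, Nat.card_eq_fintype_card, smul_eq_mul]

theorem card_submodule_finrank_eq {k : ℕ} (hk : k ≤ Module.finrank F M) :
    (Nat.card {W : Submodule F M // Module.finrank F W = k} : ℚ) =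
      qBinomial (Nat.card F) (Module.finrank F M) k := by
  have h := card_submodule_mul_prod (F := F) (M := M) hk
  have hq : 1 < Nat.card F := Finite.one_lt_card
  generalize Nat.card F = q at *
  generalize Module.finrank F M = d at *
  have hq0 : (q : ℚ) ≠ 0 := by
    have : q ≠ 0 := by omega
    exact_mod_cast this
  have hprod : ∀ d, k ≤ d → ((∏ i ∈ Finset.range k, (q ^ d - q ^ i) : ℕ) : ℚ) =
      (∏ i ∈ Finset.range k, (q : ℚ) ^ i) *
        ∏ i ∈ Finset.range k, ((q : ℚ) ^ (d - i) - 1) := by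
    intro d hd
    rw [Nat.cast_prod, ← Finset.prod_mul_distrib]
    refine Finset.prod_congr rfl fun i hi => ?_
    have hi := Finset.mem_range.1 hi
    rw [Nat.cast_sub (Nat.pow_le_pow_right (by omega) (by omega)), mul_sub, ← pow_add,
      Nat.add_sub_cancel' (by omega)]
    push_cast
    ring
  have hrefl : ∏ i ∈ Finset.range k, ((q : ℚ) ^ (k - i) - 1) =
      ∏ i ∈ Finset.range k, ((q : ℚ) ^ (i + 1) - 1) := by
    rw [← Finset.prod_range_reflect]
    refine Finset.prod_congr rfl fun i hi => ?_
    have hi := Finset.mem_range.1 hi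
    congr 2
    omega
  have h' := congrArg (Nat.cast : ℕ → ℚ) h
  rw [Nat.cast_mul, hprod k le_rfl, hprod d hk, hrefl, mul_left_comm] at h'
  rw [qBinomial, Finset.prod_div_distrib, eq_div_iff]
  · exact mul_left_cancel₀ (Finset.prod_ne_zero_iff.2 fun i _ => pow_ne_zero _ hq0) h'
  · exact Finset.prod_ne_zero_iff.2 fun i _ => pow_succ_sub_one_ne_zero hq i

theorem sum_submodule_finrank [Fintype (Submodule F M)] (f : ℕ → PowerSeries ℚ) :
    ∑ W : Submodule F M, f (Module.finrank F W) =
      ∑ k ∈ Finset.range (Module.finrank F M + 1),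
        PowerSeries.C (qBinomial (Nat.card F) (Module.finrank F M) k) * f k := by
  classical
  rw [← Finset.sum_fiberwise_of_maps_to (s := Finset.univ)
    (t := Finset.range (Module.finrank F M + 1)) (g := fun W : Submodule F M => Module.finrank F W)
    fun W _ => Finset.mem_range_succ_iff.2 W.finrank_le]
  refine Finset.sum_congr rfl fun k hk => ?_
  rw [Finset.sum_congr rfl fun W hW => by rw [(Finset.mem_filter.1 hW).2], Finset.sum_const,
    ← card_submodule_finrank_eq (Finset.mem_range_succ_iff.1 hk), Nat.card_eq_fintype_card,
    Fintype.card_subtype, map_natCast, nsmul_eq_mul]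

theorem sum_submodule_le_finrank (v : Submodule F M) [Fintype {x // x ≤ v}]
    (f : ℕ → PowerSeries ℚ) :
    ∑ x : {x // x ≤ v}, f (Module.finrank F x.1) =
      ∑ k ∈ Finset.range (Module.finrank F v + 1),
        PowerSeries.C (qBinomial (Nat.card F) (Module.finrank F v) k) * f k := by
  let e : Submodule F v ≃ {x // x ≤ v} := (Submodule.mapIic v).toEquiv
  have : Fintype (Submodule F v) := Fintype.ofEquiv _ e.symm
  rw [← sum_submodule_finrank]
  refine (Fintype.sum_equiv e
    (fun W => f (Module.finrank F W)) (fun x => f (Module.finrank F x.1)) fun W => ?_).symm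
  exact congrArg f
    (Submodule.equivMapOfInjective v.subtype v.subtype_injective W).finrank_eq

end CountSubspaces

/-! ### The Hilbert series of the subspace graph. -/

section SubspaceGraph

variable (F : Type*) [Field F] (n : ℕ)

theorem isGraded_subspaceGraph : (subspaceGraph F n).IsGraded where
  head_lt_tail e := e.2.lt
  exists_edge h := by
    obtain ⟨w, hxw, hwv⟩ := exists_le_covBy_of_lt h
    exact ⟨⟨(_, w), hwv⟩, rfl, hxw⟩
  level_bot := finrank_bot F _
  level_strictMono _ _ h := Submodule.finrank_lt_finrank_of_lt h

variable [Finite F]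

/-- The solution of the triangular system `sum_vertexSeries`. The correction in dimension zero
reflects that no letter has the zero subspace as its vertex. -/
theorem one_sub_X_mul_vertexSeries (v : Submodule F (Fin n → F)) :
    (1 - PowerSeries.X) * (subspaceGraph F n).vertexSeries v =
      (PowerSeries.X * (qPochhammer (Nat.card F) (Module.finrank F v) -
        if Module.finrank F v = 0 then 1 else 0)) *
        degreeSeries fun u : {u // (subspaceGraph F n).IsNormalWord u} =>
          LayeredGraph.wordDegree u.1 := by
  have := Fintype.ofFinite (Submodule F (Fin n → F))
  set H := degreeSeries fun u : {u // (subspaceGraph F n).IsNormalWord u} =>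
    LayeredGraph.wordDegree u.1
  induction hd : Module.finrank F v using Nat.strong_induction_on generalizing v with
  | _ d ih =>
    have := Fintype.ofFinite {x // x ≤ v}
    have h1 := (isGraded_subspaceGraph F n).sum_vertexSeries v
    have h2 := sum_submodule_le_finrank v fun k => (PowerSeries.X : PowerSeries ℚ) ^ (d - k) *
      (PowerSeries.X * (qPochhammer (Nat.card F) k - if k = 0 then 1 else 0))
    have h3 : ∑ k ∈ Finset.range (d + 1), PowerSeries.C (qBinomial (Nat.card F) d k) *
        ((PowerSeries.X : PowerSeries ℚ) ^ (d - k) *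
          (PowerSeries.X * (qPochhammer (Nat.card F) k - if k = 0 then 1 else 0))) =
        PowerSeries.X * (1 - PowerSeries.X ^ d) := by
      have h4 : PowerSeries.X * PowerSeries.X ^ d = ∑ k ∈ Finset.range (d + 1),
          PowerSeries.C (qBinomial (Nat.card F) d k) * ((PowerSeries.X : PowerSeries ℚ) ^ (d - k) *
            (PowerSeries.X * if k = 0 then 1 else 0)) := by
        rw [Finset.sum_eq_single 0]
        · simp [qBinomial_zero_right, mul_comm]
        · intro k _ hk
          simp [hk]
        · simp
      have h5 : PowerSeries.X * 1 = ∑ k ∈ Finset.range (d + 1), PowerSeries.X *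
          (PowerSeries.C (qBinomial (Nat.card F) d k) *
            (PowerSeries.X ^ (d - k) * qPochhammer (Nat.card F) k)) := by
        rw [← Finset.mul_sum, sum_qBinomial_mul_qPochhammer Finite.one_lt_card]
      rw [mul_sub PowerSeries.X 1, h4, h5, ← Finset.sum_sub_distrib]
      exact Finset.sum_congr rfl fun k _ => by ring
    have h4 : (1 - PowerSeries.X) * ∑ k ∈ Finset.range d, (PowerSeries.X : PowerSeries ℚ) ^ (k + 1) =
        PowerSeries.X * (1 - PowerSeries.X ^ d) := by
      simp only [pow_succ']
      rw [← Finset.mul_sum, mul_left_comm, mul_neg_geom_sum]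
    change ∑ x : {x // x ≤ v}, PowerSeries.X ^ (Module.finrank F v - Module.finrank F x.1) *
      (subspaceGraph F n).vertexSeries x.1 =
      (∑ k ∈ Finset.range (Module.finrank F v), PowerSeries.X ^ (k + 1)) * H at h1
    rw [hd] at h1 h2
    rw [h3] at h2
    -- Both the actual series and the claimed ones satisfy the system at `v`. By induction their
    -- differences vanish for `x < v`, which leaves the term `x = v`, whose coefficient is `1`.
    have h5 : ∑ x : {x // x ≤ v}, PowerSeries.X ^ (d - Module.finrank F x.1) *
        ((1 - PowerSeries.X) * (subspaceGraph F n).vertexSeries x.1 -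
          PowerSeries.X * (qPochhammer (Nat.card F) (Module.finrank F x.1) -
            if Module.finrank F x.1 = 0 then 1 else 0) * H) = 0 := by
      refine Eq.trans ?_ (sub_eq_zero_of_eq (congrArg (· * H) (h4.trans h2.symm)))
      rw [Finset.sum_mul, mul_assoc, ← h1, Finset.mul_sum, ← Finset.sum_sub_distrib]
      exact Finset.sum_congr rfl fun x _ => by ring
    rw [Finset.sum_eq_single ⟨v, le_rfl⟩] at h5
    · simp only [hd, Nat.sub_self, pow_zero, one_mul] at h5
      exact sub_eq_zero.1 h5
    · intro x _ hx
      have hlt : x.1 < v := lt_of_le_of_ne x.2 fun h => hx (Subtype.ext h)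
      rw [ih _ (hd ▸ Submodule.finrank_lt_finrank_of_lt hlt) x.1 rfl, sub_self, mul_zero]
    · simp

/-- In `(1 - t) H = (1 - t) + (1 - t) ∑ S_x` the correction at the zero subspace contributes `-t H`,
which cancels the `-t H` on the left. -/
theorem hilbertSeries_subspaceGraph_mul (K : Type*) [Field K] :
    (subspaceGraph F n).hilbertSeries K *
      (1 - PowerSeries.X * ∑ m ∈ Finset.range (n + 1),
        PowerSeries.C (qBinomial (Nat.card F) n m) * qPochhammer (Nat.card F) m) =
      1 - PowerSeries.X := by
  have := Fintype.ofFinite (Submodule F (Fin n → F))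
  have h := congrArg (fun f => (1 - PowerSeries.X) * f)
    (LayeredGraph.degreeSeries_normalWord (Γ := subspaceGraph F n))
  rw [(isGraded_subspaceGraph F n).hilbertSeries_eq K]
  simp only [mul_add, mul_one, Finset.mul_sum, one_sub_X_mul_vertexSeries] at h
  have hs := sum_submodule_finrank (F := F) (M := Fin n → F) fun k => PowerSeries.X *
    (qPochhammer (Nat.card F) k - if k = 0 then 1 else 0)
  rw [Module.finrank_fin_fun] at hs
  have h0 : ∑ k ∈ Finset.range (n + 1), PowerSeries.C (qBinomial (Nat.card F) n k) *
      ((PowerSeries.X : PowerSeries ℚ) * if k = 0 then 1 else 0) = PowerSeries.X := by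
    rw [Finset.sum_eq_single 0]
    · simp [qBinomial_zero_right]
    · intro k _ hk
      simp [hk]
    · simp
  simp only [mul_sub _ (qPochhammer _ _)] at hs h
  rw [← Finset.sum_mul, hs] at h
  simp only [mul_sub (PowerSeries.C _), Finset.sum_sub_distrib] at h
  rw [h0, Finset.sum_congr rfl fun k _ => mul_left_comm _ _ _, ← Finset.mul_sum] at h
  linear_combination h

end SubspaceGraph

/-- The identity is one of formal power series in `t = X` over `ℚ`. The inverse is a genuine
one, since the Hilbert series has constant coefficient `1` (this is part of the claim: the inverse
of a power series without constant term is `0` by convention, and the right side is not `0`). -/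
theorem theorem4 (K : Type*) [Field K] (F : Type*) [Field F] [Finite F] (q : ℕ)
    (hq : Nat.card F = q) (n : ℕ) :
    (1 - (PowerSeries.X : PowerSeries ℚ)) * ((subspaceGraph F n).hilbertSeries K)⁻¹ =
      1 - PowerSeries.X * ∑ m ∈ Finset.range (n + 1),
        PowerSeries.C (qBinomial q n m) *
          ∏ i ∈ Finset.range (n - m), (1 - PowerSeries.C ((q : ℚ) ^ i) * PowerSeries.X) := by
  subst hq
  have h := hilbertSeries_subspaceGraph_mul F n K
  have h0 : PowerSeries.constantCoeff ((subspaceGraph F n).hilbertSeries K) ≠ 0 := by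
    have := congrArg PowerSeries.constantCoeff h
    simp only [map_mul, map_sub, map_one, PowerSeries.constantCoeff_X, zero_mul, sub_zero,
      mul_one] at this
    rw [this]
    exact one_ne_zero
  -- Passing to `n - m` is harmless by the symmetry of the `q`-binomial coefficient.
  have hsum : ∑ m ∈ Finset.range (n + 1), PowerSeries.C (qBinomial (Nat.card F) n m) *
      ∏ i ∈ Finset.range (n - m), (1 - PowerSeries.C ((Nat.card F : ℚ) ^ i) * PowerSeries.X) =
      ∑ m ∈ Finset.range (n + 1), PowerSeries.C (qBinomial (Nat.card F) n m) *
        qPochhammer (Nat.card F) m := by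
    rw [← Finset.sum_range_reflect]
    refine Finset.sum_congr rfl fun m hm => ?_
    have hm := Finset.mem_range_succ_iff.1 hm
    rw [Nat.add_sub_cancel, qBinomial_symm Finite.one_lt_card hm, Nat.sub_sub_self hm, qPochhammer]
  rw [hsum, ← h, mul_right_comm, PowerSeries.mul_inv_cancel _ h0, one_mul]
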